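/- Let $n \ge 5$ be an integer, let $K$ be a field of characteristic zero, and let $H$ be the complete $(n-2)$-uniform hypergraph on the vertex set $\{1,\dots,n\}$, i.e. the hyperedges of $H$ are exactly the subsets of $\{1,\dots,n\}$ of size $n-2$. For $r \ge -1$ let $\Lambda_r$ be the set of ordered partitions $(B_1,\dots,B_{r+2})$ of $\{1,\dots,n\}$ into $r+2$ nonempty blocks at least one of which contains a hyperedge of $H$. Let $\sim$ be the equivalence relation on $\pm\Lambda_r$ generated by $(B_1,\dots,B_{r+2}) \sim (-1)^{r+1}(B_2,\dots,B_{r+2},B_1)$, write $[B_1,\dots,B_{r+2}]$ for the class of $(B_1,\dots,B_{r+2})$, and represent each class, up to sign, by its unique member with $1 \in B_1$. Let $C_r$ be the $K$-vector space with basis the classes $[B_1,\dots,B_{r+2}]$ with $1 \in B_1$. The cyclic coloring complex $\Delta(H)$ is $$\cdots \to C_r \xrightarrow{\partial_r} C_{r-1} \to \cdots \to C_0 \xrightarrow{\partial_0} C_{-1} \xrightarrow{\partial_{-1}} 0,$$ where, for $r \ge 0$, $$\partial_r[B_1,\dots,B_{r+2}] = \sum_{i=1}^{r+1} (-1)^{i+1}[B_1,\dots,B_i\cup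 B_{i+1},\dots,B_{r+2}] + (-1)^{r+3}[B_1\cup B_{r+2},B_2,\dots,B_{r+1}],$$ and its homology is $HC_r(\Delta(H)) = \ker(\partial_r)/\operatorname{im}(\partial_{r+1})$. Then, for $-1 \le r \le 1$, $$\dim_K HC_r(\Delta(H)) = \binom{n}{r+1}.$$ -/

import Mathlib

noncomputable section

namespace CyclicColoring

/-- A hypergraph is `k`-uniform if all of its hyperedges have size `k`. -/
def IsUniform {α : Type*} (H : Hypergraph α) (k : ℕ) : Prop :=
  ∀ e ∈ H.edgeSet, e.encard = k

/-- A `k`-uniform hypergraph is complete if every set of `k` vertices is a hyperedge. -/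
def IsCompleteUniform {α : Type*} (H : Hypergraph α) (k : ℕ) : Prop :=
  IsUniform H k ∧ ∀ e ⊆ H.vertexSet, e.encard = k → e ∈ H.edgeSet

/-- The faces with `m` blocks of the cyclic coloring complex of a hypergraph `H` with vertex set
`{1, …, n}`. The vertices `1, …, n` are the elements `0, …, n - 1` of `Fin n`. An ordered set
partition into `m` nonempty blocks is given by the surjective map `label` sending each vertex to the
position (counted from `0`) of its block: the block in position `i` is `label ⁻¹' {i}`.

A face of the cyclic coloring complex is a class `[B₁, …, Bₘ]` of ordered partitions, at least one
block of which contains a hyperedge of `H`, modulo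
`(B₁, …, Bₘ) ∼ (-1)^(m-1) (B₂, …, Bₘ, B₁)`; it is represented by the unique member of its class whose
first block contains the first vertex. -/
@[ext]
structure Face {n : ℕ} (H : Hypergraph (Fin n)) (m : ℕ) where
  /-- the position of the block of a vertex -/
  label : Fin n → Fin m
  /-- the blocks are nonempty -/
  surjective : Function.Surjective label
  /-- the first vertex is in the first block -/
  first_mem : ∀ v : Fin n, (v : ℕ) = 0 → (label v : ℕ) = 0
  /-- some block contains a hyperedge -/
  exists_edge : ∃ i : Fin m, ∃ e ∈ H.edgeSet, e ⊆ label ⁻¹' {i}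

/-- Uniting blocks of a face along a surjective map of positions that fixes the first position. -/
def Face.unite {n : ℕ} {H : Hypergraph (Fin n)} {m l : ℕ} (F : Face H m)
    (f : Fin m → Fin l) (hf : Function.Surjective f)
    (hf0 : ∀ i : Fin m, (i : ℕ) = 0 → (f i : ℕ) = 0) : Face H l where
  label := f ∘ F.label
  surjective := hf.comp F.surjective
  first_mem v hv := hf0 _ (F.first_mem v hv)
  exists_edge := by
    obtain ⟨i, e, he, h⟩ := F.exists_edge
    exact ⟨f i, e, he, fun v hv => congrArg f (h hv)⟩

/-- `[B₁, …, Bₘ₊₂] ↦ [B₁, …, Bᵢ ∪ Bᵢ₊₁, …, Bₘ₊₂]`, the position `i` being counted from `0`. -/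
def Face.mergeAdjacent {n : ℕ} {H : Hypergraph (Fin n)} {m : ℕ} (F : Face H (m + 2))
    (i : Fin (m + 1)) : Face H (m + 1) :=
  F.unite (fun j => i.predAbove j) (Fin.predAbove_surjective i) (by
    intro j hj
    obtain rfl : j = 0 := Fin.ext hj
    simp)

/-- `[B₁, …, Bₘ₊₂] ↦ [B₁ ∪ Bₘ₊₂, B₂, …, Bₘ₊₁]`. -/
def Face.mergeEnds {n : ℕ} {H : Hypergraph (Fin n)} {m : ℕ} (F : Face H (m + 2)) :
    Face H (m + 1) :=
  F.unite (fun j => if h : (j : ℕ) < m + 1 then ⟨j, h⟩ else 0)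
    (fun j => ⟨j.castSucc, by simp [Nat.lt_succ_iff.mp j.isLt]⟩) (by
    intro j hj
    simp [hj])

/-- The chains with `m` blocks: the vector space with basis the faces with `m` blocks. The chain
space `C_r` is `Chain K H (r + 2)`. -/
def Chain (K : Type*) [Field K] {n : ℕ} (H : Hypergraph (Fin n)) (m : ℕ) : Type _ :=
  Face H m →₀ K

instance (K : Type*) [Field K] {n : ℕ} (H : Hypergraph (Fin n)) (m : ℕ) :
    AddCommGroup (Chain K H m) :=
  inferInstanceAs (AddCommGroup (Face H m →₀ K))

instance (K : Type*) [Field K] {n : ℕ} (H : Hypergraph (Fin n)) (m : ℕ) :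
    Module K (Chain K H m) :=
  inferInstanceAs (Module K (Face H m →₀ K))

/-- The faces with `m` blocks form a basis of the chains with `m` blocks. -/
def faceBasis (K : Type*) [Field K] {n : ℕ} (H : Hypergraph (Fin n)) (m : ℕ) :
    Module.Basis (Face H m) K (Chain K H m) :=
  Module.Basis.ofRepr (LinearEquiv.refl K (Face H m →₀ K))

/-- The boundary map from chains with `m + 1` blocks to chains with `m` blocks, that is,
`∂_r` for `m = r + 1`. It is zero for `m = 0`, and otherwise it sends `[B₁, …, Bᵣ₊₂]` to
`∑ i = 1, …, r + 1, (-1)^(i+1) [B₁, …, Bᵢ ∪ Bᵢ₊₁, …, Bᵣ₊₂] + (-1)^(r+3) [B₁ ∪ Bᵣ₊₂, B₂, …, Bᵣ₊₁]`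
(positions are counted from `0` in the code). -/
def boundary (K : Type*) [Field K] {n : ℕ} (H : Hypergraph (Fin n)) :
    (m : ℕ) → Chain K H (m + 1) →ₗ[K] Chain K H m
  | 0 => 0
  | m + 1 => (faceBasis K H (m + 2)).constr K fun F =>
      ∑ i : Fin (m + 1), (-1 : K) ^ (i : ℕ) • faceBasis K H (m + 1) (F.mergeAdjacent i)
        + (-1 : K) ^ (m + 1) • faceBasis K H (m + 1) F.mergeEnds

/-- The homology of the cyclic coloring complex `Δ(H)` in degree `s - 1`:
`HC_r(Δ(H)) = ker ∂_r / im ∂_{r+1}` for `r = s - 1 ≥ -1`. -/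
abbrev Homology (K : Type*) [Field K] {n : ℕ} (H : Hypergraph (Fin n)) (s : ℕ) : Type _ :=
  LinearMap.ker (boundary K H s) ⧸
    (LinearMap.range (boundary K H (s + 1))).submoduleOf (LinearMap.ker (boundary K H s))

end CyclicColoring

end

noncomputable section

namespace CyclicColoring

variable {n : ℕ} {H : Hypergraph (Fin n)}

/-! A block contains a hyperedge exactly when at most two vertices lie outside it. So a face has at
most three blocks, and up to rotation it is the whole vertex set, a large block followed by a set of
one or two vertices, or a large block followed by two singletons `{a}`, `{b}` in order. The chain
spaces therefore have dimensions `1`, `n + n.choose 2`, `2 * n.choose 2`, and `0` beyond.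

The map `∂₀` vanishes (`boundary_one`). Writing `[S]` for the class of the complement of `S`
followed by `S`, `∂₁` sends the face of `(a, b)` to `[{a}] + [{b}] - [{a, b}]`
(`boundary_pairFace`). This is symmetric in `a` and `b`, and each `[{a, b}]` occurs for only one
unordered pair, so `∂₁` has rank `n.choose 2` (`finrank_range_boundary_two`). Rank-nullity gives the
homology dimensions `1`, `n`, `n.choose 2`. -/

theorem exists_edge_subset_iff (hV : H.vertexSet = Set.univ) {k : ℕ} (hH : IsCompleteUniform H k)
    (A : Finset (Fin n)) : (∃ e ∈ H.edgeSet, e ⊆ (A : Set (Fin n))) ↔ k ≤ A.card := by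
  constructor
  · rintro ⟨e, he, heA⟩
    have h := Set.encard_le_encard heA
    rw [hH.1 e he, Set.encard_coe_eq_coe_finsetCard] at h
    exact_mod_cast h
  · intro h
    obtain ⟨B, hBA, hB⟩ := Finset.exists_subset_card_eq h
    refine ⟨B, hH.2 B (by simp [hV]) ?_, by exact_mod_cast hBA⟩
    rw [Set.encard_coe_eq_coe_finsetCard, hB]

theorem exists_edge_iff (hV : H.vertexSet = Set.univ) (hH : IsCompleteUniform H (n - 2)) {m : ℕ}
    (g : Fin n → Fin m) (i : Fin m) :
    (∃ e ∈ H.edgeSet, e ⊆ g ⁻¹' {i}) ↔ (Finset.univ.filter fun v => g v ≠ i).card ≤ 2 := by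
  have h := exists_edge_subset_iff hV hH (Finset.univ.filter fun v => g v = i)
  have hc := Finset.card_filter_add_card_filter_not (s := (Finset.univ : Finset (Fin n)))
    (fun v => g v = i)
  have hs : ((Finset.univ.filter fun v => g v = i : Finset (Fin n)) : Set (Fin n)) = g ⁻¹' {i} := by
    ext; simp
  rw [hs] at h
  rw [h]
  simp only [Finset.card_univ, Fintype.card_fin, ne_eq] at hc ⊢
  omega

/-- The face obtained from an ordered partition, given as a labelling, by rotating the blocks so
that the first vertex lies in the first block. -/
def Face.ofLabeling [NeZero n] {m : ℕ} [NeZero m] (g : Fin n → Fin m)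
    (hg : Function.Surjective g) (hi : ∃ i, ∃ e ∈ H.edgeSet, e ⊆ g ⁻¹' {i}) : Face H m where
  label v := g v - g 0
  surjective i := by
    obtain ⟨v, hv⟩ := hg (i + g 0)
    exact ⟨v, by simp [hv]⟩
  first_mem v hv := by
    obtain rfl : v = 0 := Fin.ext hv
    simp
  exists_edge := by
    obtain ⟨i, e, he, h⟩ := hi
    exact ⟨i - g 0, e, he, fun v hv => congrArg (· - g 0) (h hv)⟩

theorem Face.label_zero [NeZero n] {m : ℕ} [NeZero m] (F : Face H m) : F.label 0 = 0 :=
  Fin.ext (F.first_mem 0 rfl)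

instance {m : ℕ} : Finite (Face H m) :=
  Finite.of_injective Face.label fun _ _ h => Face.ext h

theorem finrank_chain (K : Type*) [Field K] (m : ℕ) :
    Module.finrank K (Chain K H m) = Nat.card (Face H m) :=
  Module.finrank_eq_nat_card_basis (faceBasis K H m)

instance (K : Type*) [Field K] (m : ℕ) : Module.Finite K (Chain K H m) :=
  Module.Finite.of_basis (faceBasis K H m)

/-- The possible small blocks of a face with two blocks. -/
abbrev SmallSet (n : ℕ) : Type := {S : Finset (Fin n) // S.card = 1 ∨ S.card = 2}

/-- The labelling with `S` in position `1` and its complement in position `0`. -/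
def setLabel (S : Finset (Fin n)) (v : Fin n) : Fin 2 := if v ∈ S then 1 else 0

/-- The labelling with `a` in position `1`, `b` in position `2` and all else in position `0`. -/
def pairLabel (a b : Fin n) (v : Fin n) : Fin 3 := if v = a then 1 else if v = b then 2 else 0

theorem exists_notMem (S : Finset (Fin n)) (h : S.card < n) : ∃ v, v ∉ S := by
  by_contra! hS
  rw [Finset.eq_univ_iff_forall.mpr hS] at h
  simp at h

theorem setLabel_surjective (hn : 5 ≤ n) (S : SmallSet n) :
    Function.Surjective (setLabel S.1) := by
  have hS := S.2
  obtain ⟨v, hv⟩ := exists_notMem S.1 (by omega)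
  obtain ⟨w, hw⟩ : S.1.Nonempty := Finset.card_pos.mp (by omega)
  intro i
  fin_cases i
  · exact ⟨v, by simp [setLabel, hv]⟩
  · exact ⟨w, by simp [setLabel, hw]⟩

theorem pairLabel_surjective (hn : 5 ≤ n) {a b : Fin n} (hab : a ≠ b) :
    Function.Surjective (pairLabel a b) := by
  obtain ⟨v, hv⟩ := exists_notMem {a, b} (by have := Finset.card_le_two (a := a) (b := b); omega)
  simp only [Finset.mem_insert, Finset.mem_singleton, not_or] at hv
  intro i
  fin_cases i
  · exact ⟨v, by simp [pairLabel, hv]⟩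
  · exact ⟨a, by simp [pairLabel]⟩
  · exact ⟨b, by simp [pairLabel, hab.symm]⟩

/-- Each of the other `m - 1 ≥ 3` blocks would contribute a vertex outside the large block. -/
theorem isEmpty_face (hV : H.vertexSet = Set.univ) (hH : IsCompleteUniform H (n - 2)) {m : ℕ}
    (hm : 4 ≤ m) : IsEmpty (Face H m) := by
  refine ⟨fun F => ?_⟩
  obtain ⟨i, hi⟩ := F.exists_edge
  rw [exists_edge_iff hV hH] at hi
  have h : (Finset.univ.erase i).card ≤ (Finset.univ.filter fun v => F.label v ≠ i).card := by
    refine Finset.card_le_card_of_surjOn F.label fun j hj => ?_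
    obtain ⟨v, rfl⟩ := F.surjective j
    exact ⟨v, by simpa using hj, rfl⟩
  rw [Finset.card_erase_of_mem (Finset.mem_univ i), Finset.card_univ, Fintype.card_fin] at h
  omega

/-- Both ways of merging two blocks give the same face, with opposite signs. -/
theorem boundary_one (K : Type*) [Field K] : boundary K H 1 = 0 := by
  refine (faceBasis K H 2).ext fun F => ?_
  have h : F.mergeAdjacent 0 = F.mergeEnds := Face.ext (funext fun v => Fin.ext (by omega))
  change (faceBasis K H 2).constr K _ _ = _
  simp [Module.Basis.constr_basis, h]

/-! ### Classification and count of the faces -/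

section Complete

variable [NeZero n] (hn : 5 ≤ n) (hV : H.vertexSet = Set.univ) (hH : IsCompleteUniform H (n - 2))

/-- The face whose blocks are a small set and its complement. -/
def setFace (S : SmallSet n) : Face H 2 :=
  Face.ofLabeling (setLabel S.1) (setLabel_surjective hn S) ⟨0, by
    rw [exists_edge_iff hV hH]
    have hS : (Finset.univ.filter fun v => setLabel S.1 v ≠ 0) = S.1 := by
      ext v; by_cases h : v ∈ S.1 <;> simp [setLabel, h]
    have := S.2
    rw [hS]
    omega⟩

/-- The face whose blocks are, up to rotation, the complement of `{a, b}`, then `{a}`, then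
`{b}`. -/
def pairFace (p : {p : Fin n × Fin n // p.1 ≠ p.2}) : Face H 3 :=
  Face.ofLabeling (pairLabel p.1.1 p.1.2) (pairLabel_surjective hn p.2) ⟨0, by
    rw [exists_edge_iff hV hH]
    refine (Finset.card_le_card ?_).trans (Finset.card_le_two (a := p.1.1) (b := p.1.2))
    intro v hv
    simp only [pairLabel] at hv
    simp only [Finset.mem_insert, Finset.mem_singleton]
    by_contra! h
    simp [h] at hv⟩

theorem setFace_bijective : Function.Bijective (setFace hn hV hH) := by
  constructor
  · intro S T h
    have hS := S.2
    have hT := T.2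
    have h' : ∀ v, setLabel S.1 v - setLabel S.1 0 = setLabel T.1 v - setLabel T.1 0 :=
      fun v => congrFun (congrArg Face.label h) v
    -- As `n ≥ 5`, some vertex lies in both large blocks; its label is `0` on both sides, so
    -- comparing there shows that both labellings were rotated by the same amount.
    obtain ⟨v, hv⟩ := exists_notMem (S.1 ∪ T.1) (by
      have := Finset.card_union_le S.1 T.1
      omega)
    simp only [Finset.mem_union, not_or] at hv
    have h0 : setLabel S.1 0 = setLabel T.1 0 := by simpa [setLabel, hv] using h' v
    ext w
    have hw := h' w
    rw [h0, sub_left_inj] at hw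
    by_cases h1 : w ∈ S.1 <;> by_cases h2 : w ∈ T.1 <;> simp_all [setLabel]
  · intro F
    obtain ⟨i, hi⟩ := F.exists_edge
    rw [exists_edge_iff hV hH] at hi
    set S := Finset.univ.filter fun v => F.label v ≠ i with hS
    have hpos : 0 < S.card := by
      obtain ⟨v, hv⟩ := F.surjective (i + 1)
      refine Finset.card_pos.mpr ⟨v, ?_⟩
      simp [hS, hv]
    -- Rotating by `i` moves the large block to position `0`.
    have key : ∀ v, setLabel S v = F.label v - i := by
      intro v
      have : ∀ x i : Fin 2, (if x ≠ i then 1 else 0) = x - i := by decide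
      simpa [setLabel, hS] using this (F.label v) i
    refine ⟨⟨S, by omega⟩, Face.ext (funext fun v => ?_)⟩
    change setLabel S v - setLabel S 0 = _
    rw [key, key, F.label_zero]
    simp

theorem pairFace_bijective : Function.Bijective (pairFace hn hV hH) := by
  constructor
  · rintro ⟨⟨a, b⟩, hab⟩ ⟨⟨c, d⟩, hcd⟩ h
    have h' : ∀ v, pairLabel a b v - pairLabel a b 0 = pairLabel c d v - pairLabel c d 0 :=
      fun v => congrFun (congrArg Face.label h) v
    obtain ⟨v, hv⟩ := exists_notMem {a, b, c, d} (by
      have := Finset.card_le_four (a := a) (b := b) (c := c) (d := d)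
      omega)
    simp only [Finset.mem_insert, Finset.mem_singleton, not_or] at hv
    have h0 : pairLabel a b 0 = pairLabel c d 0 := by simpa [pairLabel, hv] using h' v
    simp only [h0, sub_left_inj] at h'
    have ha := h' a
    have hb := h' b
    simp only [pairLabel, if_true, hab.symm, if_false] at ha hb
    have hac : a = c := by
      by_contra hne
      rw [if_neg hne] at ha
      split_ifs at ha <;> simp at ha
    have hbd : b = d := by
      by_contra hne
      rw [if_neg hne] at hb
      split_ifs at hb <;> simp at hb
    subst hac hbd
    rfl
  · intro F
    obtain ⟨i, hi⟩ := F.exists_edge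
    rw [exists_edge_iff hV hH] at hi
    obtain ⟨a, ha⟩ := F.surjective (i + 1)
    obtain ⟨b, hb⟩ := F.surjective (i + 2)
    have hd : ∀ i : Fin 3, i + 1 ≠ i ∧ i + 2 ≠ i ∧ i + 1 ≠ i + 2 := by decide
    have hab : a ≠ b := by
      rintro rfl
      exact (hd i).2.2 (ha.symm.trans hb)
    have hS : ({a, b} : Finset (Fin n)) = Finset.univ.filter fun v => F.label v ≠ i := by
      refine Finset.eq_of_subset_of_card_le ?_ (by rwa [Finset.card_pair hab])
      intro v hv
      simp only [Finset.mem_insert, Finset.mem_singleton] at hv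
      rcases hv with rfl | rfl
      · simp [ha]
      · simp [hb]
    have key : ∀ v, pairLabel a b v = F.label v - i := by
      intro v
      unfold pairLabel
      split_ifs with h1 h2
      · simp [h1, ha]
      · simp [h2, hb]
      · have : v ∉ ({a, b} : Finset (Fin n)) := by simp [h1, h2]
        rw [hS] at this
        simp only [Finset.mem_filter, Finset.mem_univ, true_and, not_not] at this
        simp [this]
    refine ⟨⟨(a, b), hab⟩, Face.ext (funext fun v => ?_)⟩
    change pairLabel a b v - pairLabel a b 0 = _
    rw [key, key, F.label_zero]
    simp

include hn hV hH in
theorem card_face_two : Nat.card (Face H 2) = n + n.choose 2 := by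
  rw [← Nat.card_eq_of_bijective _ (setFace_bijective hn hV hH), Nat.card_eq_fintype_card,
    Fintype.card_subtype, Finset.filter_or, Finset.card_union_of_disjoint]
  · rw [← Finset.powerset_univ, ← Finset.powersetCard_eq_filter, ← Finset.powersetCard_eq_filter]
    simp
  · rw [Finset.disjoint_filter]
    omega

include hn hV hH in
theorem card_face_three : Nat.card (Face H 3) = 2 * n.choose 2 := by
  have h : (Finset.univ.filter fun p : Fin n × Fin n => p.1 ≠ p.2) =
      (Finset.univ : Finset (Fin n)).offDiag := by
    ext; simp
  rw [← Nat.card_eq_of_bijective _ (pairFace_bijective hn hV hH), Nat.card_eq_fintype_card,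
    Fintype.card_subtype, h, Finset.offDiag_card, Finset.card_univ, Fintype.card_fin,
    Nat.choose_two_right, Nat.mul_div_cancel' (Nat.even_mul_pred_self n).two_dvd, Nat.mul_sub_one]

include hV hH in
theorem card_face_one : Nat.card (Face H 1) = 1 := by
  rw [Nat.card_eq_one_iff_unique]
  refine ⟨⟨fun F G => Face.ext (Subsingleton.elim _ _)⟩, ⟨⟨fun _ => 0, fun i => ⟨0, ?_⟩, ?_, 0, ?_⟩⟩⟩
  · exact Subsingleton.elim _ _
  · simp
  · rw [exists_edge_iff hV hH]
    simp

/-! ### The rank of `∂₁` -/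

variable (K : Type*) [Field K]

/-- The sign relating a face with two blocks to its rotation in which the small set is last. -/
def setSign (S : Finset (Fin n)) : K := if setLabel S 0 = 1 then -1 else 1

theorem setSign_mul_self (S : Finset (Fin n)) : setSign K S * setSign K S = 1 := by
  unfold setSign
  split_ifs <;> simp

/-- The class of the ordered partition consisting of the complement of `S`, then `S`. -/
def setChain (S : SmallSet n) : Chain K H 2 :=
  setSign K S.1 • faceBasis K H 2 (setFace hn hV hH S)

theorem faceBasis_setFace (S : SmallSet n) :
    faceBasis K H 2 (setFace hn hV hH S) = setSign K S.1 • setChain hn hV hH K S := by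
  rw [setChain, smul_smul, setSign_mul_self, one_smul]

/-- Rotating two blocks changes the sign, which `setChain` absorbs; rotating three does not, so
`pairFace` needs no correction. The formula thus does not depend on which block contains the first
vertex. -/
theorem boundary_pairFace (p : {p : Fin n × Fin n // p.1 ≠ p.2}) :
    boundary K H 2 (faceBasis K H 3 (pairFace hn hV hH p)) =
      setChain hn hV hH K ⟨{p.1.1}, by simp⟩ + setChain hn hV hH K ⟨{p.1.2}, by simp⟩ -
        setChain hn hV hH K ⟨{p.1.1, p.1.2}, by simp [Finset.card_pair p.2]⟩ := by
  obtain ⟨⟨a, b⟩, hab⟩ := p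
  have ha : ∀ v, setLabel {a} v = if pairLabel a b v = 1 then 1 else 0 := by
    intro v
    by_cases h1 : v = a <;> by_cases h2 : v = b <;> simp [setLabel, pairLabel, h1, h2]
  have hb : ∀ v, setLabel {b} v = if pairLabel a b v = 2 then 1 else 0 := by
    intro v
    by_cases h1 : v = a <;> by_cases h2 : v = b <;> simp_all [setLabel, pairLabel]
  have hc : ∀ v, setLabel {a, b} v = if pairLabel a b v = 0 then 0 else 1 := by
    intro v
    by_cases h1 : v = a <;> by_cases h2 : v = b <;> simp_all [setLabel, pairLabel]
  set F := pairFace hn hV hH ⟨(a, b), hab⟩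
  have hl : ∀ v, F.label v = pairLabel a b v - pairLabel a b 0 := fun _ => rfl
  -- Identifies a merged face from maps of positions alone: `f` is the merging, `s` marks the
  -- positions that make up `S`. The last hypothesis is then decidable once the position of the
  -- first vertex is fixed.
  have hface : ∀ (G : Face H 2) (S : SmallSet n) (f : Fin 3 → Fin 2) (s : Fin 3 → Fin 2),
      (∀ v, G.label v = f (F.label v)) → (∀ v, setLabel S.1 v = s (pairLabel a b v)) →
      (∀ y, f (y - pairLabel a b 0) = s y - s (pairLabel a b 0)) →
      G = setFace hn hV hH S := by
    intro G S f s h1 h2 h3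
    refine Face.ext (funext fun v => ?_)
    change _ = setLabel S.1 v - setLabel S.1 0
    rw [h1, hl, h3, h2, h2]
  have hbd : boundary K H 2 (faceBasis K H 3 F) =
      faceBasis K H 2 (F.mergeAdjacent 0) - faceBasis K H 2 (F.mergeAdjacent 1) +
        faceBasis K H 2 F.mergeEnds := by
    change (faceBasis K H 3).constr K _ _ = _
    rw [Module.Basis.constr_basis]
    simp [Fin.sum_univ_two, sub_eq_add_neg]
  have h0 := fun S s => hface (F.mergeAdjacent 0) S (fun j => (0 : Fin 2).predAbove j) s fun _ => rfl
  have h1 := fun S s => hface (F.mergeAdjacent 1) S (fun j => (1 : Fin 2).predAbove j) s fun _ => rfl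
  have h2 := fun S s => hface F.mergeEnds S (fun j => if h : (j : ℕ) < 2 then ⟨j, h⟩ else 0) s
    fun _ => rfl
  have hsa : setSign K {a} = if pairLabel a b 0 = 1 then -1 else 1 := by
    by_cases h : pairLabel a b 0 = 1 <;> simp [setSign, ha, h]
  have hsb : setSign K {b} = if pairLabel a b 0 = 2 then -1 else 1 := by
    by_cases h : pairLabel a b 0 = 2 <;> simp [setSign, hb, h]
  have hsc : setSign K {a, b} = if pairLabel a b 0 = 0 then 1 else -1 := by
    by_cases h : pairLabel a b 0 = 0 <;> simp [setSign, hc, h]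
  rw [hbd]
  generalize pairLabel a b 0 = x at h0 h1 h2 hsa hsb hsc
  obtain rfl | rfl | rfl : x = 0 ∨ x = 1 ∨ x = 2 :=
    (by decide : ∀ x : Fin 3, x = 0 ∨ x = 1 ∨ x = 2) x
  · rw [h0 ⟨{b}, by simp⟩ (fun y => if y = 2 then 1 else 0) hb (by decide),
      h1 ⟨{a, b}, by simp [Finset.card_pair hab]⟩ (fun y => if y = 0 then 0 else 1) hc (by decide),
      h2 ⟨{a}, by simp⟩ (fun y => if y = 1 then 1 else 0) ha (by decide)]
    simp only [faceBasis_setFace, hsa, hsb, hsc]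
    simp
    abel
  · rw [h0 ⟨{a, b}, by simp [Finset.card_pair hab]⟩ (fun y => if y = 0 then 0 else 1) hc (by decide),
      h1 ⟨{a}, by simp⟩ (fun y => if y = 1 then 1 else 0) ha (by decide),
      h2 ⟨{b}, by simp⟩ (fun y => if y = 2 then 1 else 0) hb (by decide)]
    simp only [faceBasis_setFace, hsa, hsb, hsc]
    simp
    abel
  · rw [h0 ⟨{a}, by simp⟩ (fun y => if y = 1 then 1 else 0) ha (by decide),
      h1 ⟨{b}, by simp⟩ (fun y => if y = 2 then 1 else 0) hb (by decide),
      h2 ⟨{a, b}, by simp [Finset.card_pair hab]⟩ (fun y => if y = 0 then 0 else 1) hc (by decide)]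
    simp only [faceBasis_setFace, hsa, hsb, hsc]
    simp
    abel

/-- The boundary of the two faces whose small blocks are the singletons in `S`. -/
def pairBoundary (S : {S : Finset (Fin n) // S.card = 2}) : Chain K H 2 :=
  ∑ a ∈ S.1, setChain hn hV hH K ⟨{a}, by simp⟩ - setChain hn hV hH K ⟨S.1, Or.inr S.2⟩

theorem boundary_pairFace_eq_pairBoundary (p : {p : Fin n × Fin n // p.1 ≠ p.2}) :
    boundary K H 2 (faceBasis K H 3 (pairFace hn hV hH p)) =
      pairBoundary hn hV hH K ⟨{p.1.1, p.1.2}, Finset.card_pair p.2⟩ := by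
  rw [boundary_pairFace, pairBoundary, Finset.sum_pair p.2]

theorem range_boundary_two :
    LinearMap.range (boundary K H 2) = Submodule.span K (Set.range (pairBoundary hn hV hH K)) := by
  rw [LinearMap.range_eq_map, ← (faceBasis K H 3).span_eq, Submodule.map_span, ← Set.range_comp]
  congr 1
  ext x
  constructor
  · rintro ⟨F, rfl⟩
    obtain ⟨p, rfl⟩ := (pairFace_bijective hn hV hH).2 F
    exact ⟨_, (boundary_pairFace_eq_pairBoundary hn hV hH K p).symm⟩
  · rintro ⟨⟨S, hS⟩, rfl⟩
    obtain ⟨a, b, hab, rfl⟩ := Finset.card_eq_two.mp hS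
    exact ⟨_, boundary_pairFace_eq_pairBoundary hn hV hH K ⟨(a, b), hab⟩⟩

theorem coord_setChain (S T : SmallSet n) :
    (faceBasis K H 2).coord (setFace hn hV hH S) (setChain hn hV hH K T) =
      if S = T then setSign K T.1 else 0 := by
  have h : setFace hn hV hH T = setFace hn hV hH S ↔ S = T :=
    ⟨fun h => ((setFace_bijective hn hV hH).1 h).symm, fun h => by rw [h]⟩
  classical
  simp [setChain, Finsupp.single_apply, h]

/-- The signed coordinate at `[S]`, with `S` a pair, is a dual functional: the singleton terms do
not meet it, and only the boundary indexed by `S` involves `[S]`. -/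
theorem linearIndependent_pairBoundary : LinearIndependent K (pairBoundary hn hV hH K) := by
  have hne : ∀ (S : {S : Finset (Fin n) // S.card = 2}) (a : Fin n), S.1 ≠ {a} := by
    intro S a h
    have := S.2
    simp [h] at this
  refine .of_pairwise_dual_eq_zero_one _ (fun S => -setSign K S.1 •
    (faceBasis K H 2).coord (setFace hn hV hH ⟨S.1, Or.inr S.2⟩)) (fun S T hST => ?_) fun S => ?_
  · have : S.1 ≠ T.1 := fun h => hST (Subtype.ext h)
    simp only [pairBoundary, LinearMap.smul_apply, map_sub, map_sum, coord_setChain,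
      Subtype.mk.injEq, hne, this]
    simp
  · simp only [pairBoundary, LinearMap.smul_apply, map_sub, map_sum, coord_setChain,
      Subtype.mk.injEq, hne]
    simp [setSign_mul_self]

include hn hV hH in
theorem finrank_range_boundary_two :
    Module.finrank K (LinearMap.range (boundary K H 2)) = n.choose 2 := by
  rw [range_boundary_two hn hV hH, finrank_span_eq_card (linearIndependent_pairBoundary hn hV hH K),
    Fintype.card_subtype, ← Finset.powerset_univ, ← Finset.powersetCard_eq_filter]
  simp

end Complete

/-! ### Dimensions of the homology -/

theorem finrank_homology (K : Type*) [Field K] (s : ℕ) {a b : ℕ}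
    (h : LinearMap.range (boundary K H (s + 1)) ≤ LinearMap.ker (boundary K H s))
    (ha : Module.finrank K (LinearMap.range (boundary K H (s + 1))) = a)
    (hb : Module.finrank K (LinearMap.ker (boundary K H s)) = b) :
    Module.finrank K (Homology K H s) = b - a := by
  have := Submodule.finrank_quotient_add_finrank
    ((LinearMap.range (boundary K H (s + 1))).submoduleOf (LinearMap.ker (boundary K H s)))
  rw [(Submodule.submoduleOfEquivOfLe h).finrank_eq, ha, hb] at this
  exact Nat.eq_sub_of_add_eq this

end CyclicColoring

end

theorem theorem3p6 {K : Type*} [Field K] [CharZero K] (n : ℕ) (hn : 5 ≤ n)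
    (H : Hypergraph (Fin n)) (hV : H.vertexSet = Set.univ)
    (hH : CyclicColoring.IsCompleteUniform H (n - 2)) (r : ℤ) (hr : -1 ≤ r) (hr' : r ≤ 1) :
    Module.finrank K (CyclicColoring.Homology K H (r + 1).toNat) = n.choose (r + 1).toNat := by
  open CyclicColoring in
  have : NeZero n := ⟨by omega⟩
  obtain rfl | rfl | rfl : r = -1 ∨ r = 0 ∨ r = 1 := by omega
  · have h0 : boundary K H 0 = 0 := rfl
    refine (finrank_homology (a := 0) (b := 1) K 0 ?_ ?_ ?_).trans (by simp)
    · rw [h0, LinearMap.ker_zero]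
      exact le_top
    · rw [zero_add, boundary_one, LinearMap.range_zero, finrank_bot]
    · rw [h0, LinearMap.ker_zero, finrank_top, finrank_chain, card_face_one hV hH]
  · refine (finrank_homology K 1 ?_ (finrank_range_boundary_two hn hV hH K)
      (b := n + n.choose 2) ?_).trans (by simp)
    · rw [boundary_one, LinearMap.ker_zero]
      exact le_top
    · rw [boundary_one, LinearMap.ker_zero, finrank_top, finrank_chain, card_face_two hn hV hH]
  · have := isEmpty_face hV hH (le_refl 4)
    have : Subsingleton (Chain K H 4) := inferInstanceAs (Subsingleton (Face H 4 →₀ K))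
    have h3 : boundary K H 3 = 0 := LinearMap.ext fun x => by
      rw [Subsingleton.elim x 0, map_zero, map_zero]
    refine (finrank_homology K 2 (a := 0) (b := n.choose 2) ?_ ?_ ?_).trans (by simp)
    · rw [h3, LinearMap.range_zero]
      exact bot_le
    · rw [h3, LinearMap.range_zero, finrank_bot]
    · have h := LinearMap.finrank_range_add_finrank_ker (boundary K H 2)
      rw [finrank_range_boundary_two hn hV hH, finrank_chain, card_face_three hn hV hH] at h
      omega
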